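/- Let $\Gamma$ be a (finite, simple, connected) distance-regular graph with diameter $D\ge 3$, valency $k$ and intersection numbers $b_i,c_i$, with smallest eigenvalue $\theta_{\min}$ and second largest (distinct) eigenvalue $\theta_1$. Suppose that $\Gamma$ has classical parameters $(D,b,\alpha,\beta)$ with $b>0$, that is, writing $[j]=1+b+\cdots+b^{j-1}$, $$b_i=([D]-[i])(\beta-\alpha[i])\quad(0\le i\le D-1),\qquad c_i=[i](1+\alpha[i-1])\quad(1\le i\le D).$$ Suppose further that $\Gamma$ is geometric: there is a set of Delsarte cliques (cliques with exactly $1+\frac{k}{-\theta_{\min}}$ vertices) such that every edge lies in exactly one of them. For $j=1,2$ let $\phi_j$ be the number of vertices at distance $j$ from $x$ in a Delsarte clique $C$, where $x$ is any vertex at distance $j$ from $C$. Let $(u_i)_{0\le i\le D}$ be the standard sequence of $\theta_1$: $u_0=1$, $u_1=\theta_1/k$, and $c_iu_{i-1}+(k-b_i-c_i)u_i+b_iu_{i+1}=\theta_1u_i$ for $1\le i\le D-1$. Then $u_1\neq 0$ and 1. $\left(\phi_1-\frac{bu_2}{u_1}\right)^2\ge\left(\beta+\frac1{u_1}\right)\left(\phi_1-b^2-2b-1+\frac1{u_1}\right)$;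 2. $\left(\phi_2-\frac{b^2u_3}{u_1}\right)^2\ge\left(\beta+\frac1{u_1}\right)\left(\phi_2-b^4-2b^3-b^2\left(1+\frac{2u_2-1}{u_1}\right)-1+\frac1{u_1}\right)$. If moreover $b\ge 2$, then 3. $\left(\phi_1+\frac{7b^2}{2}\right)^2\ge\beta\left(\phi_1-b^2-2b-1\right)$; 4. $\left(\phi_2+\frac{7b^3}{2}\right)^2\ge\beta\left(\phi_2-b^4-\frac{11b^3}{2}-b^2-1\right)$. -/

import Mathlib

open scoped BigOperators

/-- The set of eigenvalues of a finite graph: the spectrum of its adjacency matrix over `ℝ`. -/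
def graphEigenvalues {V : Type*} [Fintype V] [DecidableEq V] (G : SimpleGraph V)
    [DecidableRel G.Adj] : Set ℝ :=
  spectrum ℝ (G.adjMatrix ℝ)

/-- `θ` is the smallest eigenvalue of `G`. -/
def IsSmallestEigenvalue {V : Type*} [Fintype V] [DecidableEq V] (G : SimpleGraph V)
    [DecidableRel G.Adj] (θ : ℝ) : Prop :=
  IsLeast (graphEigenvalues G) θ

/-- `θ` is the second largest among the distinct eigenvalues of `G`. -/
def IsSecondLargestEigenvalue {V : Type*} [Fintype V] [DecidableEq V] (G : SimpleGraph V)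
    [DecidableRel G.Adj] (θ : ℝ) : Prop :=
  ∃ θ₀ : ℝ, IsGreatest (graphEigenvalues G) θ₀ ∧ IsGreatest (graphEigenvalues G \ {θ₀}) θ

/-- `G` is a (finite, connected) distance-regular graph with intersection numbers
`bi i` and `ci i`: for vertices `x`, `y` at distance `i`, exactly `bi i` neighbours of `y` are
at distance `i + 1` from `x`, and exactly `ci i` neighbours of `y` are at distance `i - 1`
from `x`. (The values of `bi`, `ci` beyond the diameter play no role.) -/
def IsDistanceRegular {V : Type*} [Fintype V] [DecidableEq V] (G : SimpleGraph V)
    [DecidableRel G.Adj] (bi ci : ℕ → ℕ) : Prop :=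
  G.Connected ∧ ∀ x y : V,
    (Finset.univ.filter fun z => G.Adj y z ∧ G.dist x z = G.dist x y + 1).card
        = bi (G.dist x y) ∧
    (Finset.univ.filter fun z => G.Adj y z ∧ G.dist x z + 1 = G.dist x y).card
        = ci (G.dist x y)

/-- The number `[j] = 1 + b + ⋯ + b ^ (j - 1)`. -/
noncomputable def gaussNumber (b : ℝ) (j : ℕ) : ℝ := ∑ i ∈ Finset.range j, b ^ i

theorem gaussNumber_eq (b : ℝ) (j : ℕ) :
    gaussNumber b j = if b = 1 then (j : ℝ) else (b ^ j - 1) / (b - 1) := by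
  unfold gaussNumber
  split_ifs with h
  · simp [h]
  · exact geom_sum_eq h j

/-- The graph `G`, distance-regular with intersection numbers `bi`, `ci`, has classical
parameters `(D, b, α, β)`; in particular its diameter is `D`. -/
def HasClassicalParameters {V : Type*} [Fintype V] [DecidableEq V] (G : SimpleGraph V)
    [DecidableRel G.Adj] (bi ci : ℕ → ℕ) (D : ℕ) (b α β : ℝ) : Prop :=
  IsDistanceRegular G bi ci ∧ G.diam = D ∧
  (∀ i : ℕ, i < D →
    (bi i : ℝ) = (gaussNumber b D - gaussNumber b i) * (β - α * gaussNumber b i)) ∧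
  (∀ i : ℕ, 1 ≤ i → i ≤ D →
    (ci i : ℝ) = gaussNumber b i * (1 + α * gaussNumber b (i - 1)))

/-- `(u i)`, `0 ≤ i ≤ D`, is the standard sequence corresponding to `θ` for the intersection
numbers `bi`, `ci` and diameter `D`; here the valency is `bi 0` and `a_i = bi 0 - bi i - ci i`. -/
def IsStandardSequence (bi ci : ℕ → ℕ) (D : ℕ) (θ : ℝ) (u : ℕ → ℝ) : Prop :=
  u 0 = 1 ∧ u 1 = θ / (bi 0 : ℝ) ∧
  ∀ i : ℕ, 1 ≤ i → i < D →
    (ci i : ℝ) * u (i - 1) + ((bi 0 : ℝ) - (bi i : ℝ) - (ci i : ℝ)) * u i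
      + (bi i : ℝ) * u (i + 1) = θ * u i

/-- A Delsarte clique of a regular graph with valency `k` and smallest eigenvalue `θ`:
a clique with `1 + k / (-θ)` vertices. -/
def IsDelsarteClique {V : Type*} [Fintype V] [DecidableEq V] (G : SimpleGraph V)
    [DecidableRel G.Adj] (C : Finset V) : Prop :=
  G.IsClique (C : Set V) ∧
  ∃ (k : ℕ) (θ : ℝ), G.IsRegularOfDegree k ∧ IsSmallestEigenvalue G θ ∧
    (C.card : ℝ) = 1 + (k : ℝ) / (-θ)

/-- `G` is geometric: there is a set of Delsarte cliques such that every edge lies in exactly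
one of them. -/
def IsGeometric {V : Type*} [Fintype V] [DecidableEq V] (G : SimpleGraph V)
    [DecidableRel G.Adj] : Prop :=
  ∃ 𝒞 : Set (Finset V), (∀ C ∈ 𝒞, IsDelsarteClique G C) ∧
    ∀ x y : V, G.Adj x y → ∃! C : Finset V, C ∈ 𝒞 ∧ x ∈ C ∧ y ∈ C

/-- The vertex `x` is at distance `j` from the vertex set `C`. -/
def IsDistToSet {V : Type*} (G : SimpleGraph V) (x : V) (C : Finset V) (j : ℕ) : Prop :=
  (∃ y ∈ C, G.dist x y = j) ∧ ∀ y ∈ C, j ≤ G.dist x y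

/-- `p` is the geometric parameter `φ_j`: the number of vertices at distance `j` from `x` in a
Delsarte clique `C`, for some vertex `x` at distance `j` from `C`. No independence of the pair
`(x, C)` is assumed: a statement about every such `p` is a statement about every such pair. -/
def IsGeometricPhi {V : Type*} [Fintype V] [DecidableEq V] (G : SimpleGraph V)
    [DecidableRel G.Adj] (j p : ℕ) : Prop :=
  ∃ (C : Finset V) (x : V), IsDelsarteClique G C ∧ IsDistToSet G x C j ∧
    (C.filter fun y => G.dist x y = j).card = p

/-!
Let `v` be the cosine sequence of an eigenvalue `θ`. The matrix with entries `v (dist x y)` lies in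
the adjacency algebra and is a positive multiple of the projection onto the eigenspace of `θ`, hence
positive semidefinite. Restrict it to a clique `C` and one further vertex `x` at distance `j` from
`C`, whose distances to the vertices of `C` take only the values `j` (`φ j` times) and `j + 1`. The
entries on `C` are `1` and `v 1`, so positivity is one scalar inequality, a Schur complement.

For classical parameters with `0 < b` the smallest eigenvalue is `-[D]`, its cosine sequence
alternates in sign, and a Delsarte clique has `1 + β` vertices, which makes the block of `C`
singular; this forces `φ j = 1 + α [j]`. The second largest eigenvalue has the cosine sequence
`v (i + 1) = v i - (1 - v 1) / b ^ i`, and its Schur complements for `j = 1, 2` are inequalities 1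
and 2. If `2 ≤ b`, the right-hand sides of 3 and 4 are nonpositive unless `b ^ 2 + 2 b ≤ α`, and in
that case `1 / v 1 ≤ b ^ 2 + b + 1`, so 3 and 4 follow from 1 and 2.
-/

section DistanceRegular

variable {V : Type*} [Fintype V] [DecidableEq V] {G : SimpleGraph V} [DecidableRel G.Adj]
  {bi ci : ℕ → ℕ} {D : ℕ} {θ : ℝ}

/-- The matrix whose `(x, y)` entry is `g (dist x y)`; these matrices form the Bose–Mesner algebra
of a distance-regular graph. -/
noncomputable def radialMatrix {V : Type*} (G : SimpleGraph V) (g : ℕ → ℝ) : Matrix V V ℝ :=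
  Matrix.of fun x y => g (G.dist x y)

/-- The action of the adjacency matrix on functions of the distance to a fixed vertex: the
tridiagonal intersection matrix. At `i = 0` the term `g (i - 1)` carries the coefficient
`ci 0 = 0`. -/
def radialOp (bi ci : ℕ → ℕ) (g : ℕ → ℝ) (i : ℕ) : ℝ :=
  (ci i : ℝ) * g (i - 1) + ((bi 0 : ℝ) - bi i - ci i) * g i + (bi i : ℝ) * g (i + 1)

/-- `v` is an eigenvector of the intersection matrix for `θ`, normalized by `v 0 = 1`. Unlike
`IsStandardSequence`, this includes the equation at `i = D`, which forces `θ` to be an eigenvalue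
of the graph. -/
def IsCosineSequence (bi ci : ℕ → ℕ) (D : ℕ) (θ : ℝ) (v : ℕ → ℝ) : Prop :=
  v 0 = 1 ∧ ∀ i ≤ D, radialOp bi ci v i = θ * v i

omit [Fintype V] [DecidableEq V] [DecidableRel G.Adj] in
theorem radialMatrix_add (g h : ℕ → ℝ) :
    radialMatrix G g + radialMatrix G h = radialMatrix G (g + h) := rfl

omit [Fintype V] [DecidableEq V] [DecidableRel G.Adj] in
theorem radialMatrix_transpose (g : ℕ → ℝ) :
    (radialMatrix G g).transpose = radialMatrix G g := by
  ext x y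
  simp [radialMatrix, SimpleGraph.dist_comm]

omit [DecidableRel G.Adj] in
theorem radialMatrix_single_zero (hG : G.Connected) (r : ℝ) :
    radialMatrix G (Pi.single 0 r) = algebraMap ℝ (Matrix V V ℝ) r := by
  ext x y
  simp [radialMatrix, Matrix.algebraMap_matrix_apply, Pi.single_apply, hG.dist_eq_zero_iff]

omit [Fintype V] [DecidableEq V] [DecidableRel G.Adj] in
theorem exists_adj_dist_eq (hG : G.Connected) {i : ℕ} (hi : i < G.diam) :
    ∃ x y z, G.Adj y z ∧ G.dist x y = i ∧ G.dist x z = i + 1 := by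
  have := hG.nonempty
  obtain ⟨x, w, hxw⟩ := G.exists_dist_eq_diam
  obtain ⟨p, hp⟩ := hG.exists_walk_length_eq_dist x w
  have dist_getVert : ∀ n ≤ p.length, G.dist x (p.getVert n) = n := fun n hn => by
    have htake := (SimpleGraph.dist_le (p.take n)).trans_eq (p.take_length n)
    have hdrop := (SimpleGraph.dist_le (p.drop n)).trans_eq (p.drop_length n)
    have := hG.dist_triangle (u := x) (v := p.getVert n) (w := w)
    omega
  exact ⟨x, p.getVert i, p.getVert (i + 1), p.adj_getVert_succ (by omega),
    dist_getVert _ (by omega), dist_getVert _ (by omega)⟩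

omit [Fintype V] [DecidableEq V] [DecidableRel G.Adj] in
theorem exists_dist_eq_of_le_diam (hG : G.Connected) {i : ℕ} (hi : i ≤ G.diam) :
    ∃ x y, G.dist x y = i := by
  have := hG.nonempty
  rcases hi.eq_or_lt with rfl | hlt
  · exact G.exists_dist_eq_diam
  · obtain ⟨x, y, -, -, hy, -⟩ := exists_adj_dist_eq hG hlt
    exact ⟨x, y, hy⟩

theorem eq_of_radialOp_eq (hb : ∀ i < D, bi i ≠ 0) {f g : ℕ → ℝ} (h0 : f 0 = g 0)
    (hf : ∀ i < D, radialOp bi ci f i = θ * f i) (hg : ∀ i < D, radialOp bi ci g i = θ * g i) :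
    ∀ i ≤ D, f i = g i := by
  intro i
  induction i using Nat.strong_induction_on with
  | _ i ih =>
    intro hi
    rcases i with _ | i
    · exact h0
    have hprev := ih (i - 1) (by omega) (by omega)
    have hcur := ih i (by omega) (by omega)
    have hfi := hf i hi
    have hgi := hg i hi
    rw [radialOp, hprev, hcur] at hfi
    rw [radialOp] at hgi
    exact mul_left_cancel₀ (Nat.cast_ne_zero.2 (hb i hi)) (by linarith)

namespace IsDistanceRegular

theorem degree_eq (h : IsDistanceRegular G bi ci) (x : V) : G.degree x = bi 0 := by
  have hx := (h.2 x x).1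
  rw [SimpleGraph.dist_self] at hx
  rw [← hx, ← SimpleGraph.card_neighborFinset_eq_degree]
  congr 1
  ext z
  simp

theorem ci_zero (h : IsDistanceRegular G bi ci) : ci 0 = 0 := by
  obtain ⟨x⟩ := h.1.nonempty
  have hx := (h.2 x x).2
  rw [SimpleGraph.dist_self] at hx
  simp [← hx]

theorem dist_le_diam (h : IsDistanceRegular G bi ci) (x y : V) : G.dist x y ≤ G.diam := by
  have := h.1.nonempty
  exact SimpleGraph.dist_le_diam (SimpleGraph.connected_iff_ediam_ne_top.1 h.1)

theorem bi_pos (h : IsDistanceRegular G bi ci) {i : ℕ} (hi : i < G.diam) : 0 < bi i := by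
  obtain ⟨x, y, z, hyz, hy, hz⟩ := exists_adj_dist_eq h.1 hi
  rw [← hy, ← (h.2 x y).1, Finset.card_pos]
  exact ⟨z, by simp [hyz, hy, hz]⟩

theorem ci_succ_pos (h : IsDistanceRegular G bi ci) {i : ℕ} (hi : i < G.diam) :
    0 < ci (i + 1) := by
  obtain ⟨x, y, z, hyz, hy, hz⟩ := exists_adj_dist_eq h.1 hi
  rw [← hz, ← (h.2 x z).2, Finset.card_pos]
  exact ⟨y, by simp [hyz.symm, hy, hz]⟩

theorem bi_diam (h : IsDistanceRegular G bi ci) : bi G.diam = 0 := by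
  obtain ⟨x, y, hxy⟩ := exists_dist_eq_of_le_diam h.1 le_rfl
  have hcard := (h.2 x y).1
  rw [hxy] at hcard
  rw [← hcard, Finset.card_eq_zero, Finset.filter_eq_empty_iff]
  rintro z - ⟨-, hz⟩
  have := h.dist_le_diam x z
  omega

theorem sum_neighborFinset_dist (h : IsDistanceRegular G bi ci) (x y : V) (g : ℕ → ℝ) :
    ∑ z ∈ G.neighborFinset y, g (G.dist x z) = radialOp bi ci g (G.dist x y) := by
  set i := G.dist x y
  have hstep : ∀ z ∈ G.neighborFinset y, g (G.dist x z) = g i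
      + (if G.dist x z = i + 1 then g (i + 1) - g i else 0)
      + (if G.dist x z + 1 = i then g (i - 1) - g i else 0) := by
    intro z hz
    rw [SimpleGraph.mem_neighborFinset] at hz
    have hxz := h.1.dist_triangle (u := x) (v := y) (w := z)
    have hxy := h.1.dist_triangle (u := x) (v := z) (w := y)
    rw [SimpleGraph.dist_eq_one_iff_adj.2 hz] at hxz
    rw [SimpleGraph.dist_eq_one_iff_adj.2 hz.symm] at hxy
    obtain hz | hz | hz : G.dist x z = i + 1 ∨ G.dist x z = i ∨ G.dist x z + 1 = i := by omega
    · rw [if_pos hz, if_neg (by omega), hz]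
      ring
    · simp [hz]
    · rw [if_neg (by omega), if_pos hz, show i - 1 = G.dist x z by omega]
      ring
  have hfilter (P : V → Prop) [DecidablePred P] :
      (G.neighborFinset y).filter P = Finset.univ.filter fun z => G.Adj y z ∧ P z := by
    ext z; simp
  rw [Finset.sum_congr rfl hstep, Finset.sum_add_distrib, Finset.sum_add_distrib,
    ← Finset.sum_filter, ← Finset.sum_filter, hfilter, hfilter]
  simp only [Finset.sum_const, nsmul_eq_mul, (h.2 x y).1, (h.2 x y).2,
    SimpleGraph.card_neighborFinset_eq_degree, h.degree_eq, radialOp, i]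
  ring

theorem radialMatrix_mul_adjMatrix (h : IsDistanceRegular G bi ci) (g : ℕ → ℝ) :
    radialMatrix G g * G.adjMatrix ℝ = radialMatrix G (radialOp bi ci g) := by
  ext x y
  rw [SimpleGraph.mul_adjMatrix_apply]
  exact h.sum_neighborFinset_dist x y g

theorem radialMatrix_mul_adjMatrix_eq_smul_iff (h : IsDistanceRegular G bi ci) {g : ℕ → ℝ} :
    radialMatrix G g * G.adjMatrix ℝ = θ • radialMatrix G g ↔
      ∀ i ≤ G.diam, radialOp bi ci g i = θ * g i := by
  rw [h.radialMatrix_mul_adjMatrix]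
  constructor
  · intro heq i hi
    obtain ⟨x, y, rfl⟩ := exists_dist_eq_of_le_diam h.1 hi
    exact congrFun (congrFun heq x) y
  · intro heq
    ext x y
    exact heq _ (h.dist_le_diam x y)

theorem radialMatrix_mem_adjoin_of_support_le (h : IsDistanceRegular G bi ci) {n : ℕ}
    (hn : n ≤ G.diam) : ∀ g : ℕ → ℝ, (∀ i, n < i → g i = 0) →
      radialMatrix G g ∈ Algebra.adjoin ℝ {G.adjMatrix ℝ} := by
  induction n with
  | zero =>
    intro g hg
    have hsingle : g = Pi.single 0 (g 0) := by
      ext i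
      rcases i with _ | i
      · simp
      · simpa using hg _ i.succ_pos
    rw [hsingle, radialMatrix_single_zero h.1]
    exact Subalgebra.algebraMap_mem _ _
  | succ n ih =>
    intro g hg
    have hc : (ci (n + 1) : ℝ) ≠ 0 := Nat.cast_ne_zero.2 (h.ci_succ_pos hn).ne'
    -- `f` is chosen so that `radialOp bi ci f` and `g` have the same leading value, at `n + 1`.
    set f : ℕ → ℝ := Pi.single n (g (n + 1) / ci (n + 1)) with hf
    have hf_mem := ih (by omega) f fun i hi => Pi.single_eq_of_ne hi.ne' _
    have hLf_mem := mul_mem hf_mem (Algebra.self_mem_adjoin_singleton ℝ (G.adjMatrix ℝ))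
    rw [h.radialMatrix_mul_adjMatrix] at hLf_mem
    have hrest := ih (by omega) (g - radialOp bi ci f) fun i hi => by
      obtain rfl | hi : i = n + 1 ∨ n + 1 < i := by omega
      · simp [radialOp, hf, mul_div_cancel₀ _ hc, show n + 1 + 1 ≠ n by omega]
      · simp [radialOp, hf, hg i hi, show i ≠ n by omega,
          show i - 1 ≠ n by omega, show i + 1 ≠ n by omega]
    simpa [radialMatrix_add] using add_mem hrest hLf_mem

theorem mem_adjoin_adjMatrix_iff (h : IsDistanceRegular G bi ci) {M : Matrix V V ℝ} :
    M ∈ Algebra.adjoin ℝ {G.adjMatrix ℝ} ↔ ∃ g, M = radialMatrix G g := by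
  constructor
  · rw [Algebra.adjoin_singleton_eq_range_aeval]
    rintro ⟨p, rfl⟩
    induction p using Polynomial.induction_on with
    | C r => exact ⟨Pi.single 0 r, by simpa using (radialMatrix_single_zero h.1 r).symm⟩
    | add p q hp hq =>
      obtain ⟨f, hf⟩ := hp
      obtain ⟨g, hg⟩ := hq
      exact ⟨f + g, by rw [map_add, hf, hg, radialMatrix_add]⟩
    | monomial n r hn =>
      obtain ⟨f, hf⟩ := hn
      refine ⟨radialOp bi ci f, ?_⟩
      rw [← h.radialMatrix_mul_adjMatrix, ← hf, pow_succ, ← mul_assoc]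
      simp
  · rintro ⟨g, rfl⟩
    have htrunc : radialMatrix G g = radialMatrix G fun i => if i ≤ G.diam then g i else 0 := by
      ext x y
      simp [radialMatrix, h.dist_le_diam x y]
    rw [htrunc]
    exact h.radialMatrix_mem_adjoin_of_support_le le_rfl _ fun i hi => if_neg hi.not_ge

end IsDistanceRegular

theorem exists_mul_eq_smul_of_mem_adjoin {R A : Type*} [CommSemiring R] [Semiring A] [Algebra R A]
    {s : Set A} {e a : A} (hs : ∀ c ∈ s, ∃ r : R, e * c = r • e) (ha : a ∈ Algebra.adjoin R s) :
    ∃ r : R, e * a = r • e := by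
  induction ha using Algebra.adjoin_induction with
  | mem c hc => exact hs c hc
  | algebraMap r => exact ⟨r, by rw [Algebra.smul_def, Algebra.commutes]⟩
  | add c d _ _ hc hd =>
    obtain ⟨r, hr⟩ := hc
    obtain ⟨t, ht⟩ := hd
    exact ⟨r + t, by rw [mul_add, hr, ht, add_smul]⟩
  | mul c d _ _ hc hd =>
    obtain ⟨r, hr⟩ := hc
    obtain ⟨t, ht⟩ := hd
    exact ⟨r * t, by rw [← mul_assoc, hr, smul_mul_assoc, ht, smul_smul]⟩

namespace IsDistanceRegular

/- The radial matrix `E` of a cosine sequence lies in the adjacency algebra and its rows are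
eigenvectors, so `E * E` is a multiple of `E`. -/
theorem posSemidef_radialMatrix (h : IsDistanceRegular G bi ci) {v : ℕ → ℝ}
    (hv : IsCosineSequence bi ci G.diam θ v) : (radialMatrix G v).PosSemidef := by
  set E := radialMatrix G v with hE
  have hEA : E * G.adjMatrix ℝ = θ • E := h.radialMatrix_mul_adjMatrix_eq_smul_iff.2 hv.2
  obtain ⟨γ, hγ⟩ : ∃ γ : ℝ, E * E = γ • E :=
    exists_mul_eq_smul_of_mem_adjoin (by simpa using ⟨θ, hEA⟩)
      (h.mem_adjoin_adjMatrix_iff.2 ⟨v, rfl⟩)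
  have hherm : E.conjTranspose = E := by
    rw [Matrix.conjTranspose_eq_transpose_of_trivial, hE, radialMatrix_transpose]
  have hsq : (E * E).PosSemidef := by
    simpa only [hherm] using Matrix.posSemidef_conjTranspose_mul_self E
  have hγ_pos : 0 < γ := by
    obtain ⟨x⟩ := h.1.nonempty
    have hEx : E x x = 1 := by simp [hE, radialMatrix, hv.1]
    have hdiag : γ = ∑ y, E x y * E y x := by
      rw [← Matrix.mul_apply, hγ, Matrix.smul_apply, hEx, smul_eq_mul, mul_one]
    rw [hdiag]
    refine Finset.sum_pos' (fun y _ => ?_) ⟨x, Finset.mem_univ x, by rw [hEx]; norm_num⟩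
    rw [← Matrix.transpose_apply E x y, hE, radialMatrix_transpose]
    exact mul_self_nonneg _
  have hE_smul : E = γ⁻¹ • (E * E) := by rw [hγ, smul_smul, inv_mul_cancel₀ hγ_pos.ne', one_smul]
  rw [hE_smul]
  exact hsq.smul (inv_nonneg.2 hγ_pos.le)

theorem mem_graphEigenvalues_of_isCosineSequence (h : IsDistanceRegular G bi ci) {v : ℕ → ℝ}
    (hv : IsCosineSequence bi ci G.diam θ v) : θ ∈ graphEigenvalues G := by
  intro hunit
  have hmul : radialMatrix G v * (algebraMap ℝ _ θ - G.adjMatrix ℝ) = 0 := by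
    rw [mul_sub, h.radialMatrix_mul_adjMatrix_eq_smul_iff.2 hv.2, ← Algebra.commutes,
      ← Algebra.smul_def, sub_self]
  obtain ⟨x⟩ := h.1.nonempty
  have hx := congrFun (congrFun ((hunit.mul_left_eq_zero).1 hmul) x) x
  simp [radialMatrix, hv.1] at hx

theorem exists_isCosineSequence_of_mem_graphEigenvalues (h : IsDistanceRegular G bi ci)
    (hθ : θ ∈ graphEigenvalues G) : ∃ v, IsCosineSequence bi ci G.diam θ v := by
  have hint : IsIntegral ℝ (G.adjMatrix ℝ) := Matrix.isIntegral _
  have hroot : (minpoly ℝ (G.adjMatrix ℝ)).IsRoot θ := by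
    have hmem := spectrum.subset_polynomial_aeval (G.adjMatrix ℝ) (minpoly ℝ (G.adjMatrix ℝ))
      ⟨θ, hθ, rfl⟩
    have := h.1.nonempty
    simpa [minpoly.aeval] using hmem
  obtain ⟨q, hq⟩ := Polynomial.dvd_iff_isRoot.2 hroot
  have hq_ne : Polynomial.aeval (G.adjMatrix ℝ) q ≠ 0 := by
    have hq_monic : q.Monic :=
      (Polynomial.monic_X_sub_C θ).of_mul_monic_left (hq ▸ minpoly.monic hint)
    exact minpoly.aeval_ne_zero_of_dvdNotUnit_minpoly hint hq_monic
      ⟨hq_monic.ne_zero, _, Polynomial.not_isUnit_X_sub_C θ, by rw [hq, mul_comm]⟩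
  obtain ⟨g, hg⟩ := h.mem_adjoin_adjMatrix_iff.1
    (Polynomial.aeval_mem_adjoin_singleton ℝ (G.adjMatrix ℝ) (p := q))
  have hgA : radialMatrix G g * G.adjMatrix ℝ = θ • radialMatrix G g := by
    have hzero := minpoly.aeval ℝ (G.adjMatrix ℝ)
    rw [hq, mul_comm, map_mul, hg] at hzero
    simpa [mul_sub, sub_eq_zero, ← Algebra.commutes, ← Algebra.smul_def] using hzero
  have hrec := h.radialMatrix_mul_adjMatrix_eq_smul_iff.1 hgA
  have hg0 : g 0 ≠ 0 := by
    intro hg0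
    have hzero := eq_of_radialOp_eq (fun i hi => (h.bi_pos hi).ne') (g := 0) hg0
      (fun i hi => hrec i hi.le) (by simp [radialOp])
    refine hq_ne (hg.trans ?_)
    ext x y
    exact hzero _ (h.dist_le_diam x y)
  refine ⟨fun i => g i / g 0, div_self hg0, fun i hi => ?_⟩
  rw [mul_div_assoc', ← hrec i hi]
  simp only [radialOp]
  ring

end IsDistanceRegular

end DistanceRegular

theorem IsStandardSequence.eq_of_isCosineSequence {V : Type*} [Fintype V] [DecidableEq V]
    {G : SimpleGraph V} [DecidableRel G.Adj] {bi ci : ℕ → ℕ} {θ : ℝ} {u v : ℕ → ℝ}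
    (h : IsDistanceRegular G bi ci) (hu : IsStandardSequence bi ci G.diam θ u)
    (hv : IsCosineSequence bi ci G.diam θ v) : ∀ i ≤ G.diam, u i = v i := by
  have hb : ∀ i < G.diam, bi i ≠ 0 := fun i hi => (h.bi_pos hi).ne'
  refine eq_of_radialOp_eq hb (hu.1.trans hv.1.symm) (fun i hi => ?_) fun i hi => hv.2 i hi.le
  rcases i.eq_zero_or_pos with rfl | hpos
  · have hb0 : (bi 0 : ℝ) ≠ 0 := Nat.cast_ne_zero.2 (hb 0 hi)
    simp [radialOp, h.ci_zero, hu.1, hu.2.1, mul_div_cancel₀ _ hb0]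
  · exact hu.2.2 i hpos hi

section Tridiagonal

-- The Collatz–Wielandt argument: compare `g` with `m` at an index maximizing `|g i| / m i`.
theorem eigenvalue_le_of_tridiagonal_supersolution {n : ℕ} {l d r m g : ℕ → ℝ} {ρ θ : ℝ}
    (hl : ∀ i ≤ n, 0 ≤ l i) (hr : ∀ i < n, 0 ≤ r i) (hrn : r n = 0) (hm : ∀ i ≤ n, 0 < m i)
    (hsuper : ∀ i ≤ n, l i * m (i - 1) + d i * m i + r i * m (i + 1) ≤ ρ * m i)
    (hg : ∀ i ≤ n, l i * g (i - 1) + d i * g i + r i * g (i + 1) = θ * g i)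
    (hne : ∃ i ≤ n, g i ≠ 0) : θ ≤ ρ := by
  obtain ⟨i, hi, hmax⟩ := Finset.exists_max_image (Finset.range (n + 1)) (fun i => |g i| / m i)
    ⟨0, by simp⟩
  simp only [Finset.mem_range, Nat.lt_succ_iff] at hi hmax
  set c := |g i| / m i with hc
  have hgi : |g i| = c * m i := by rw [hc, div_mul_cancel₀ _ (hm i hi).ne']
  have hle : ∀ k ≤ n, |g k| ≤ c * m k := fun k hk => (div_le_iff₀ (hm k hk)).1 (hmax k hk)
  have hgi_pos : 0 < |g i| := by
    obtain ⟨k, hk, hgk⟩ := hne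
    have hc_pos : 0 < c := (div_pos (abs_pos.2 hgk) (hm k hk)).trans_le (hmax k hk)
    rw [hgi]
    exact mul_pos hc_pos (hm i hi)
  have hleft : l i * |g (i - 1)| ≤ l i * (c * m (i - 1)) :=
    mul_le_mul_of_nonneg_left (hle _ (by omega)) (hl i hi)
  have hright : |r i| * |g (i + 1)| ≤ r i * (c * m (i + 1)) := by
    rcases hi.eq_or_lt with rfl | hlt
    · simp [hrn]
    · rw [abs_of_nonneg (hr i hlt)]
      exact mul_le_mul_of_nonneg_left (hle _ hlt) (hr i hlt)
  have hle_ρ : (θ - d i) * |g i| ≤ (ρ - d i) * |g i| :=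
    calc (θ - d i) * |g i| ≤ |(θ - d i) * g i| := by
          rw [abs_mul]
          exact mul_le_mul_of_nonneg_right (le_abs_self _) (abs_nonneg _)
      _ = |l i * g (i - 1) + r i * g (i + 1)| := by
          congr 1
          linear_combination -hg i hi
      _ ≤ l i * |g (i - 1)| + |r i| * |g (i + 1)| := by
          refine (abs_add_le _ _).trans_eq ?_
          rw [abs_mul, abs_mul, abs_of_nonneg (hl i hi)]
      _ ≤ c * (l i * m (i - 1) + r i * m (i + 1)) := by linarith
      _ ≤ c * ((ρ - d i) * m i) :=
          mul_le_mul_of_nonneg_left (by linarith [hsuper i hi])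
            (div_nonneg (abs_nonneg _) (hm i hi).le)
      _ = (ρ - d i) * |g i| := by rw [hgi]; ring
  linarith [le_of_mul_le_mul_right hle_ρ hgi_pos]

variable {bi ci : ℕ → ℕ}

theorem neg_one_pow_mul_radialOp (hc : ci 0 = 0) (g : ℕ → ℝ) (i : ℕ) :
    (-1) ^ i * radialOp bi ci g i
      = -((ci i : ℝ) * ((-1) ^ (i - 1) * g (i - 1))
          + -((bi 0 : ℝ) - bi i - ci i) * ((-1) ^ i * g i)
          + (bi i : ℝ) * ((-1) ^ (i + 1) * g (i + 1))) := by
  rcases i with _ | i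
  · simp [radialOp, hc]
  · simp only [radialOp, Nat.add_sub_cancel, pow_succ]
    ring

theorem radialOp_sub_radialOp_succ (hc : ci 0 = 0) (g : ℕ → ℝ) (i : ℕ) :
    radialOp bi ci g i - radialOp bi ci g (i + 1)
      = (ci i : ℝ) * (g (i - 1) - g (i - 1 + 1))
        + ((bi 0 : ℝ) - bi i - ci (i + 1)) * (g i - g (i + 1))
        + (bi (i + 1) : ℝ) * (g (i + 1) - g (i + 1 + 1)) := by
  rcases i with _ | i
  · simp only [radialOp, hc]
    push_cast
    ring
  · simp only [radialOp, Nat.add_sub_cancel]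
    ring

end Tridiagonal

namespace IsDistanceRegular

variable {V : Type*} [Fintype V] [DecidableEq V] {G : SimpleGraph V} [DecidableRel G.Adj]
  {bi ci : ℕ → ℕ} {θ ρ : ℝ} {m : ℕ → ℝ}

theorem neg_le_of_mem_graphEigenvalues (h : IsDistanceRegular G bi ci)
    (hm : ∀ i ≤ G.diam, 0 < m i)
    (hsuper : ∀ i ≤ G.diam, (ci i : ℝ) * m (i - 1) + -((bi 0 : ℝ) - bi i - ci i) * m i
      + (bi i : ℝ) * m (i + 1) ≤ ρ * m i)
    (hθ : θ ∈ graphEigenvalues G) : -ρ ≤ θ := by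
  obtain ⟨v, hv0, hv⟩ := h.exists_isCosineSequence_of_mem_graphEigenvalues hθ
  rw [neg_le]
  refine eigenvalue_le_of_tridiagonal_supersolution (g := fun i => (-1) ^ i * v i)
    (fun _ _ => Nat.cast_nonneg _) (fun _ _ => Nat.cast_nonneg _) (by simp [h.bi_diam]) hm hsuper
    (fun i hi => ?_) ⟨0, Nat.zero_le _, by simp [hv0]⟩
  have halternating := neg_one_pow_mul_radialOp (bi := bi) h.ci_zero v i
  rw [hv i hi] at halternating
  linarith

theorem le_of_mem_graphEigenvalues_of_ne (h : IsDistanceRegular G bi ci) (hD : 0 < G.diam)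
    (hm : ∀ i < G.diam, 0 < m i)
    (hsuper : ∀ i < G.diam, (ci i : ℝ) * m (i - 1) + ((bi 0 : ℝ) - bi i - ci (i + 1)) * m i
      + (bi (i + 1) : ℝ) * m (i + 1) ≤ ρ * m i)
    (hθ : θ ∈ graphEigenvalues G) (hne : θ ≠ bi 0) : θ ≤ ρ := by
  obtain ⟨v, hv0, hv⟩ := h.exists_isCosineSequence_of_mem_graphEigenvalues hθ
  have hlt : ∀ {i}, i ≤ G.diam - 1 → i < G.diam := fun hi => by omega
  refine eigenvalue_le_of_tridiagonal_supersolution (n := G.diam - 1)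
    (r := fun i => bi (i + 1)) (g := fun i => v i - v (i + 1))
    (fun _ _ => Nat.cast_nonneg _) (fun _ _ => Nat.cast_nonneg _)
    (by simp [Nat.sub_add_cancel hD, h.bi_diam]) (fun i hi => hm i (hlt hi))
    (fun i hi => hsuper i (hlt hi)) (fun i hi => ?_) ⟨0, Nat.zero_le _, fun hv1 => hne ?_⟩
  · rw [← radialOp_sub_radialOp_succ h.ci_zero, hv i (hlt hi).le, hv (i + 1) (hlt hi)]
    ring
  · have hv_zero := hv 0 (Nat.zero_le _)
    rw [radialOp, h.ci_zero, ← sub_eq_zero.1 hv1, hv0] at hv_zero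
    push_cast at hv_zero
    linarith

end IsDistanceRegular

section GaussNumber

variable {b : ℝ}

theorem gaussNumber_zero (b : ℝ) : gaussNumber b 0 = 0 := by simp [gaussNumber]

theorem gaussNumber_one (b : ℝ) : gaussNumber b 1 = 1 := by simp [gaussNumber]

theorem gaussNumber_succ (b : ℝ) (i : ℕ) : gaussNumber b (i + 1) = 1 + b * gaussNumber b i := by
  rw [gaussNumber, Finset.sum_range_succ', gaussNumber, Finset.mul_sum, pow_zero, add_comm]
  simp only [pow_succ']

theorem gaussNumber_succ' (b : ℝ) (i : ℕ) : gaussNumber b (i + 1) = gaussNumber b i + b ^ i :=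
  Finset.sum_range_succ _ _

theorem gaussNumber_two (b : ℝ) : gaussNumber b 2 = 1 + b := by
  rw [gaussNumber_succ, gaussNumber_one, mul_one]

theorem gaussNumber_strictMono (hb : 0 < b) : StrictMono (gaussNumber b) :=
  strictMono_nat_of_lt_succ fun i => by
    rw [gaussNumber_succ']
    exact lt_add_of_pos_right _ (pow_pos hb i)

theorem gaussNumber_nonneg (hb : 0 < b) (i : ℕ) : 0 ≤ gaussNumber b i :=
  Finset.sum_nonneg fun j _ => (pow_pos hb j).le

theorem gaussNumber_pos (hb : 0 < b) {i : ℕ} (hi : 0 < i) : 0 < gaussNumber b i :=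
  (gaussNumber_zero b).symm.trans_lt (gaussNumber_strictMono hb hi)

end GaussNumber

/-- The absolute value of the `i`-th term of the cosine sequence of the smallest eigenvalue of a
graph with classical parameters `(D, b, α, β)`; the terms themselves alternate in sign. -/
noncomputable def minCosineAbs (b α β : ℝ) (i : ℕ) : ℝ :=
  ∏ j ∈ Finset.range i, (1 + α * gaussNumber b j) / (β - α * gaussNumber b j)

/-- The second largest eigenvalue of a graph with classical parameters `(D, b, α, β)`, where
`0 < b` and `0 ≤ α`. -/
noncomputable def secondEigenvalue (D : ℕ) (b α β : ℝ) : ℝ :=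
  (gaussNumber b D - 1) / b * (β - α) - 1

/-- The cosine sequence of `secondEigenvalue D b α β`; `gaussNumber b D * β` is the valency. -/
noncomputable def secondCosine (D : ℕ) (b α β : ℝ) (i : ℕ) : ℝ :=
  1 - (1 - secondEigenvalue D b α β / (gaussNumber b D * β)) * gaussNumber b⁻¹ i

section ClassicalFormulas

variable {D : ℕ} {b α β : ℝ}

theorem minCosineAbs_zero (b α β : ℝ) : minCosineAbs b α β 0 = 1 := by simp [minCosineAbs]

theorem secondEigenvalue_succ (hb : b ≠ 0) (n : ℕ) (α β : ℝ) :
    secondEigenvalue (n + 1) b α β = gaussNumber b n * (β - α) - 1 := by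
  rw [secondEigenvalue, gaussNumber_succ, add_sub_cancel_left, mul_div_cancel_left₀ _ hb]

theorem secondEigenvalue_pos (hD : 3 ≤ D) (hb : 0 < b) (hβα : 1 ≤ β - α) :
    0 < secondEigenvalue D b α β := by
  obtain ⟨n, rfl⟩ : ∃ n, D = n + 1 := ⟨D - 1, by omega⟩
  have hn : 1 < gaussNumber b n :=
    (gaussNumber_one b).symm.trans_lt (gaussNumber_strictMono hb (by omega))
  rw [secondEigenvalue_succ hb.ne', sub_pos]
  nlinarith

theorem secondEigenvalue_lt (hD : 0 < D) (hb : 0 < b) (hα : 0 ≤ α) (hβ : 0 < β) :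
    secondEigenvalue D b α β < gaussNumber b D * β := by
  obtain ⟨n, rfl⟩ := Nat.exists_eq_succ_of_ne_zero hD.ne'
  rw [Nat.succ_eq_add_one, secondEigenvalue_succ hb.ne']
  calc gaussNumber b n * (β - α) - 1 < gaussNumber b n * β := by
        linarith [mul_nonneg (gaussNumber_nonneg hb n) hα]
    _ ≤ gaussNumber b (n + 1) * β :=
        mul_le_mul_of_nonneg_right ((gaussNumber_strictMono hb).monotone n.le_succ) hβ.le

theorem secondCosine_zero (D : ℕ) (b α β : ℝ) : secondCosine D b α β 0 = 1 := by
  simp [secondCosine, gaussNumber_zero]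

theorem secondCosine_one (D : ℕ) (b α β : ℝ) :
    secondCosine D b α β 1 = secondEigenvalue D b α β / (gaussNumber b D * β) := by
  simp [secondCosine, gaussNumber_one]

theorem secondCosine_succ (D : ℕ) (b α β : ℝ) (i : ℕ) :
    secondCosine D b α β (i + 1)
      = secondCosine D b α β i - (1 - secondCosine D b α β 1) / b ^ i := by
  rw [secondCosine_one, secondCosine, gaussNumber_succ', secondCosine, inv_pow]
  ring

theorem secondCosine_one_pos (hD : 3 ≤ D) (hb : 0 < b) (hβ : 0 < β) (hβα : 1 ≤ β - α) :
    0 < secondCosine D b α β 1 := by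
  rw [secondCosine_one]
  exact div_pos (secondEigenvalue_pos hD hb hβα) (mul_pos (gaussNumber_pos hb (by omega)) hβ)

theorem secondCosine_one_lt_one (hD : 0 < D) (hb : 0 < b) (hα : 0 ≤ α) (hβ : 0 < β) :
    secondCosine D b α β 1 < 1 := by
  rw [secondCosine_one, div_lt_one (mul_pos (gaussNumber_pos hb hD) hβ)]
  exact secondEigenvalue_lt hD hb hα hβ

end ClassicalFormulas

namespace HasClassicalParameters

variable {V : Type*} [Fintype V] [DecidableEq V] {G : SimpleGraph V} [DecidableRel G.Adj]
  {bi ci : ℕ → ℕ} {D : ℕ} {b α β : ℝ} {i : ℕ}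

theorem bi_eq (hc : HasClassicalParameters G bi ci D b α β) (hi : i ≤ D) :
    (bi i : ℝ) = (gaussNumber b D - gaussNumber b i) * (β - α * gaussNumber b i) := by
  rcases hi.lt_or_eq with hlt | rfl
  · exact hc.2.2.1 i hlt
  · rw [sub_self, zero_mul, ← hc.2.1, hc.1.bi_diam, Nat.cast_zero]

theorem ci_eq (hc : HasClassicalParameters G bi ci D b α β) (hi : i ≤ D) :
    (ci i : ℝ) = gaussNumber b i * (1 + α * gaussNumber b (i - 1)) := by
  rcases i.eq_zero_or_pos with rfl | hpos
  · rw [gaussNumber_zero, zero_mul, hc.1.ci_zero, Nat.cast_zero]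
  · exact hc.2.2.2 i hpos hi

theorem valency_eq (hc : HasClassicalParameters G bi ci D b α β) :
    (bi 0 : ℝ) = gaussNumber b D * β := by
  rw [hc.bi_eq D.zero_le, gaussNumber_zero, mul_zero, sub_zero, sub_zero]

theorem beta_sub_pos (hc : HasClassicalParameters G bi ci D b α β) (hb : 0 < b) (hi : i < D) :
    0 < β - α * gaussNumber b i := by
  have hbi : (0 : ℝ) < bi i := Nat.cast_pos.2 (hc.1.bi_pos (hc.2.1 ▸ hi))
  rw [hc.bi_eq hi.le] at hbi
  exact pos_of_mul_pos_right hbi (sub_pos.2 (gaussNumber_strictMono hb hi)).le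

theorem one_add_pos (hc : HasClassicalParameters G bi ci D b α β) (hb : 0 < b) (hi : i < D) :
    0 < 1 + α * gaussNumber b i := by
  have hci : (0 : ℝ) < ci (i + 1) := Nat.cast_pos.2 (hc.1.ci_succ_pos (hc.2.1 ▸ hi))
  rw [hc.ci_eq (i := i + 1) hi, Nat.add_sub_cancel] at hci
  exact pos_of_mul_pos_right hci (gaussNumber_nonneg hb _)

theorem beta_pos (hc : HasClassicalParameters G bi ci D b α β) (hb : 0 < b) (hD : 0 < D) :
    0 < β := by
  simpa [gaussNumber_zero] using hc.beta_sub_pos hb hD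

theorem minCosineAbs_pos (hc : HasClassicalParameters G bi ci D b α β) (hb : 0 < b) (hi : i ≤ D) :
    0 < minCosineAbs b α β i :=
  Finset.prod_pos fun j hj => by
    have hjD : j < D := (Finset.mem_range.1 hj).trans_le hi
    exact div_pos (hc.one_add_pos hb hjD) (hc.beta_sub_pos hb hjD)

theorem minCosineAbs_succ_mul (hc : HasClassicalParameters G bi ci D b α β) (hb : 0 < b)
    (hi : i < D) : minCosineAbs b α β (i + 1) * (β - α * gaussNumber b i)
      = minCosineAbs b α β i * (1 + α * gaussNumber b i) := by
  rw [minCosineAbs, Finset.prod_range_succ, ← minCosineAbs, mul_assoc,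
    div_mul_cancel₀ _ (hc.beta_sub_pos hb hi).ne']

theorem minCosineAbs_recurrence (hc : HasClassicalParameters G bi ci D b α β) (hb : 0 < b)
    (hi : i ≤ D) :
    (ci i : ℝ) * minCosineAbs b α β (i - 1) + -((bi 0 : ℝ) - bi i - ci i) * minCosineAbs b α β i
        + bi i * minCosineAbs b α β (i + 1)
      = gaussNumber b D * minCosineAbs b α β i := by
  have hleft : (ci i : ℝ) * minCosineAbs b α β (i - 1)
      = gaussNumber b i * (β - α * gaussNumber b (i - 1)) * minCosineAbs b α β i := by
    rw [hc.ci_eq hi]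
    rcases i with _ | j
    · simp [gaussNumber_zero]
    · rw [Nat.add_sub_cancel]
      linear_combination -(gaussNumber b (j + 1)) * hc.minCosineAbs_succ_mul hb (i := j) hi
  have hright : (bi i : ℝ) * minCosineAbs b α β (i + 1)
      = (gaussNumber b D - gaussNumber b i) * (1 + α * gaussNumber b i)
        * minCosineAbs b α β i := by
    rw [hc.bi_eq hi]
    rcases hi.lt_or_eq with hlt | rfl
    · linear_combination (gaussNumber b D - gaussNumber b i) * hc.minCosineAbs_succ_mul hb hlt
    · ring
  rw [hleft, hright, hc.valency_eq, hc.bi_eq hi, hc.ci_eq hi]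
  ring

theorem isCosineSequence_minCosine (hc : HasClassicalParameters G bi ci D b α β) (hb : 0 < b) :
    IsCosineSequence bi ci G.diam (-gaussNumber b D) fun i => (-1) ^ i * minCosineAbs b α β i := by
  refine ⟨by simp [minCosineAbs_zero], fun i hi => ?_⟩
  have hsign : ∀ j, (-1 : ℝ) ^ j * (-1) ^ j = 1 := fun j => by rw [← mul_pow]; simp
  have halternating := neg_one_pow_mul_radialOp (bi := bi) hc.1.ci_zero
    (fun j => (-1) ^ j * minCosineAbs b α β j) i
  simp only [← mul_assoc _ _ (minCosineAbs b α β _), hsign, one_mul] at halternating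
  rw [hc.minCosineAbs_recurrence hb (hc.2.1 ▸ hi)] at halternating
  linear_combination (-1) ^ i * halternating
    - radialOp bi ci (fun j => (-1) ^ j * minCosineAbs b α β j) i * hsign i

theorem isSmallestEigenvalue (hc : HasClassicalParameters G bi ci D b α β) (hb : 0 < b) :
    IsSmallestEigenvalue G (-gaussNumber b D) :=
  ⟨hc.1.mem_graphEigenvalues_of_isCosineSequence (hc.isCosineSequence_minCosine hb), fun _ hθ =>
    hc.1.neg_le_of_mem_graphEigenvalues (fun _ hi => hc.minCosineAbs_pos hb (hc.2.1 ▸ hi))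
      (fun _ hi => (hc.minCosineAbs_recurrence hb (hc.2.1 ▸ hi)).le) hθ⟩

theorem card_delsarteClique (hc : HasClassicalParameters G bi ci D b α β) (hb : 0 < b)
    (hD : 0 < D) {C : Finset V} (hC : IsDelsarteClique G C) : (C.card : ℝ) = 1 + β := by
  obtain ⟨-, k, θ, hk, hθ, hcard⟩ := hC
  obtain ⟨x⟩ := hc.1.1.nonempty
  have hk_eq : k = bi 0 := (hk x).symm.trans (hc.1.degree_eq x)
  have hθ_eq : θ = -gaussNumber b D := hθ.unique (hc.isSmallestEigenvalue hb)
  rw [hcard, hk_eq, hθ_eq, hc.valency_eq, neg_neg,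
    mul_div_cancel_left₀ _ (gaussNumber_pos hb hD).ne']

theorem inv_pow_recurrence (hc : HasClassicalParameters G bi ci D b α β) (hb : 0 < b)
    (hi : i < D) :
    (ci i : ℝ) * b⁻¹ ^ (i - 1) + ((bi 0 : ℝ) - bi i - ci (i + 1)) * b⁻¹ ^ i
        + (bi (i + 1) : ℝ) * b⁻¹ ^ (i + 1)
      = secondEigenvalue D b α β * b⁻¹ ^ i := by
  have hleft : (ci i : ℝ) * b⁻¹ ^ (i - 1)
      = b⁻¹ ^ i * (gaussNumber b i * (b + α * (gaussNumber b i - 1))) := by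
    rw [hc.ci_eq hi.le]
    rcases i with _ | j
    · simp [gaussNumber_zero]
    · rw [Nat.add_sub_cancel, gaussNumber_succ, pow_succ]
      field_simp
      ring
  rw [hleft, hc.valency_eq, hc.bi_eq hi.le, hc.bi_eq (i := i + 1) hi, hc.ci_eq (i := i + 1) hi,
    Nat.add_sub_cancel, gaussNumber_succ, secondEigenvalue, pow_succ]
  field_simp
  ring

theorem isCosineSequence_secondCosine (hc : HasClassicalParameters G bi ci D b α β) (hb : 0 < b)
    (hD : 0 < D) :
    IsCosineSequence bi ci G.diam (secondEigenvalue D b α β) (secondCosine D b α β) := by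
  refine ⟨secondCosine_zero D b α β, fun i hi => ?_⟩
  rw [hc.2.1] at hi
  have hdiff : ∀ j, secondCosine D b α β j - secondCosine D b α β (j + 1)
      = (1 - secondCosine D b α β 1) * b⁻¹ ^ j := fun j => by
    rw [secondCosine_succ D b α β j, inv_pow]
    ring
  induction i with
  | zero =>
    have hk := mul_pos (gaussNumber_pos hb hD) (hc.beta_pos hb hD)
    simp [radialOp, hc.1.ci_zero, hc.valency_eq, secondCosine_zero, secondCosine_one,
      mul_div_cancel₀ _ hk.ne']
  | succ i ih =>
    have hstep := radialOp_sub_radialOp_succ (bi := bi) hc.1.ci_zero (secondCosine D b α β) i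
    rw [ih (Nat.le_of_succ_le hi), hdiff, hdiff, hdiff] at hstep
    linear_combination -hstep - (1 - secondCosine D b α β 1) * hc.inv_pow_recurrence hb hi
      + secondEigenvalue D b α β * hdiff i

theorem le_secondEigenvalue (hc : HasClassicalParameters G bi ci D b α β) (hb : 0 < b)
    (hD : 0 < D) {θ : ℝ} (hθ : θ ∈ graphEigenvalues G) (hne : θ ≠ bi 0) :
    θ ≤ secondEigenvalue D b α β :=
  hc.1.le_of_mem_graphEigenvalues_of_ne (hc.2.1 ▸ hD) (m := fun i => b⁻¹ ^ i)
    (fun i _ => pow_pos (inv_pos.2 hb) i)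
    (fun _ hi => (hc.inv_pow_recurrence hb (hc.2.1 ▸ hi)).le) hθ hne

theorem eq_secondEigenvalue (hc : HasClassicalParameters G bi ci D b α β) (hb : 0 < b)
    (hD : 0 < D) (hα : 0 ≤ α) {θ : ℝ} (hθ : IsSecondLargestEigenvalue G θ) :
    θ = secondEigenvalue D b α β := by
  obtain ⟨θ₀, hθ₀, hθ⟩ := hθ
  have hlt : secondEigenvalue D b α β < bi 0 :=
    (secondEigenvalue_lt hD hb hα (hc.beta_pos hb hD)).trans_eq hc.valency_eq.symm
  have hmem := hc.1.mem_graphEigenvalues_of_isCosineSequence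
    (hc.isCosineSequence_secondCosine hb hD)
  have hmem_valency : (bi 0 : ℝ) ∈ graphEigenvalues G :=
    hc.1.mem_graphEigenvalues_of_isCosineSequence (v := 1) ⟨rfl, fun i _ => by simp [radialOp]⟩
  obtain rfl : θ₀ = bi 0 := by
    by_contra hne
    exact ((hθ₀.2 hmem_valency).trans (hc.le_secondEigenvalue hb hD hθ₀.1 hne)).not_gt hlt
  exact le_antisymm (hc.le_secondEigenvalue hb hD hθ.1.1 hθ.1.2) (hθ.2 ⟨hmem, hlt.ne⟩)

end HasClassicalParameters

section Clique

theorem posSemidef_sum_nonneg {ι : Type*} {M : Matrix ι ι ℝ} (hM : M.PosSemidef) (i : ι) (s : ℝ)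
    (C : Finset ι) (t : ι → ℝ) :
    0 ≤ M i i * s ^ 2 + 2 * s * ∑ y ∈ C, M i y * t y
      + ∑ y ∈ C, ∑ z ∈ C, t y * (M y z * t z) := by
  have hsymm : ∀ y, M y i = M i y := fun y => by simpa using hM.isHermitian.apply i y
  set p : ι →₀ ℝ := Finsupp.single i s + ∑ y ∈ C, Finsupp.single y (t y)
  have hsum : ∀ F : ι → ℝ → ℝ, (∀ y, F y 0 = 0) → (∀ y a b, F y (a + b) = F y a + F y b) →
      p.sum F = F i s + ∑ y ∈ C, F y (t y) := by
    intro F hzero hadd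
    rw [Finsupp.sum_add_index' hzero hadd, Finsupp.sum_single_index (hzero i),
      ← Finsupp.sum_finsetSum_index hzero hadd]
    simp only [Finsupp.sum_single_index (hzero _)]
  refine (hM.2 p).trans_eq ?_
  have hrow : ∀ y a, p.sum (fun z c => star a * M y z * c)
      = a * (M y i * s + ∑ z ∈ C, M y z * t z) := fun y a => by
    rw [hsum _ (fun _ => mul_zero _) fun _ _ _ => mul_add _ _ _]
    simp only [star_trivial, mul_add, Finset.mul_sum, mul_assoc]
  simp only [hrow]
  rw [hsum (fun y a => a * (M y i * s + ∑ z ∈ C, M y z * t z)) (fun _ => zero_mul _)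
    fun _ _ _ => add_mul _ _ _]
  simp only [hsymm, mul_add, Finset.sum_add_distrib, Finset.mul_sum]
  have hcross : ∑ y ∈ C, t y * (M i y * s) = ∑ y ∈ C, s * (M i y * t y) :=
    Finset.sum_congr rfl fun y _ => by ring
  rw [hcross]
  simp only [← Finset.mul_sum]
  ring

variable {V : Type*} {G : SimpleGraph V} {C : Finset V} {x : V} {j : ℕ}

theorem sum_sum_clique_dist (hC : G.IsClique (C : Set V)) (v : ℕ → ℝ) (t : V → ℝ) :
    ∑ y ∈ C, ∑ z ∈ C, t y * (v (G.dist y z) * t z)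
      = v 1 * (∑ y ∈ C, t y) ^ 2 + (v 0 - v 1) * ∑ y ∈ C, t y ^ 2 := by
  classical
  have hentry : ∀ y ∈ C, ∀ z ∈ C, t y * (v (G.dist y z) * t z)
      = v 1 * (t y * t z) + if y = z then (v 0 - v 1) * t y ^ 2 else 0 := by
    intro y hy z hz
    split_ifs with hyz
    · rw [← hyz, SimpleGraph.dist_self]
      ring
    · rw [SimpleGraph.dist_eq_one_iff_adj.2 (hC hy hz hyz)]
      ring
  rw [Finset.sum_congr rfl fun y hy => Finset.sum_congr rfl (hentry y hy), sq,
    Finset.sum_mul_sum]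
  simp only [Finset.sum_add_distrib, Finset.mul_sum, Finset.sum_ite_eq]
  congr 1
  exact Finset.sum_congr rfl fun y hy => if_pos hy

theorem IsDistToSet.sum_dist (hG : G.Connected) (hC : G.IsClique (C : Set V))
    (hx : IsDistToSet G x C j) (F : ℕ → ℝ) :
    ∑ y ∈ C, F (G.dist x y) = ((C.filter fun y => G.dist x y = j).card : ℝ) * F j
      + ((C.card : ℝ) - (C.filter fun y => G.dist x y = j).card) * F (j + 1) := by
  obtain ⟨⟨y₀, hy₀, hxy₀⟩, hmin⟩ := hx
  have hentry : ∀ y ∈ C, F (G.dist x y)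
      = F (j + 1) + if G.dist x y = j then F j - F (j + 1) else 0 := by
    intro y hy
    split_ifs with hxy
    · rw [hxy]
      ring
    · have hy_min := hmin y hy
      have htriangle := hG.dist_triangle (u := x) (v := y₀) (w := y)
      have hne : y₀ ≠ y := fun heq => hxy (heq ▸ hxy₀)
      rw [SimpleGraph.dist_eq_one_iff_adj.2 (hC hy₀ hy hne), hxy₀] at htriangle
      rw [add_zero, show G.dist x y = j + 1 by omega]
  rw [Finset.sum_congr rfl hentry, Finset.sum_add_distrib, ← Finset.sum_filter]
  simp only [Finset.sum_const, nsmul_eq_mul]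
  ring

variable [Fintype V] [DecidableEq V] [DecidableRel G.Adj] {bi ci : ℕ → ℕ} {θ : ℝ} {v : ℕ → ℝ}

theorem IsDistanceRegular.clique_quadForm_nonneg (h : IsDistanceRegular G bi ci)
    (hv : IsCosineSequence bi ci G.diam θ v) (hC : G.IsClique (C : Set V)) (x : V) (s : ℝ)
    (t : V → ℝ) :
    0 ≤ s ^ 2 + 2 * s * ∑ y ∈ C, v (G.dist x y) * t y
      + (v 1 * (∑ y ∈ C, t y) ^ 2 + (1 - v 1) * ∑ y ∈ C, t y ^ 2) := by
  simpa [radialMatrix, hv.1, sum_sum_clique_dist hC v t] using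
    posSemidef_sum_nonneg (h.posSemidef_radialMatrix hv) x s C t

/- The Gram matrix of the clique has eigenvalues `1 - v 1` and `1 + (#C - 1) * v 1`, so this is the
Schur complement of its block in the Gram matrix of `insert x C`. It is obtained from the vector
orthogonal to the clique, whose coefficient at `x` is `-(1 - v 1) * (1 + (#C - 1) * v 1)`. -/
theorem IsDistanceRegular.sum_sq_clique_le (h : IsDistanceRegular G bi ci)
    (hv : IsCosineSequence bi ci G.diam θ v) (hC : G.IsClique (C : Set V)) (x : V)
    (hv1 : v 1 < 1) (hCv : 0 < 1 + ((C.card : ℝ) - 1) * v 1) :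
    (1 + ((C.card : ℝ) - 1) * v 1) * ∑ y ∈ C, v (G.dist x y) ^ 2
        - v 1 * (∑ y ∈ C, v (G.dist x y)) ^ 2
      ≤ (1 - v 1) * (1 + ((C.card : ℝ) - 1) * v 1) := by
  set A := 1 - v 1 with hA
  set B := 1 + ((C.card : ℝ) - 1) * v 1 with hB
  set σ := ∑ y ∈ C, v (G.dist x y) with hσ
  set Q := ∑ y ∈ C, v (G.dist x y) ^ 2 with hQ
  have hcard : (C.card : ℝ) * v 1 = B - A := by rw [hA, hB]; ring
  set t : V → ℝ := fun y => B * v (G.dist x y) - v 1 * σ with ht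
  have hsum : ∑ y ∈ C, t y = A * σ := by
    simp only [ht, Finset.sum_sub_distrib, ← Finset.mul_sum, ← hσ, Finset.sum_const, nsmul_eq_mul]
    linear_combination (-σ) * hcard
  have hsum_mul : ∑ y ∈ C, v (G.dist x y) * t y = B * Q - v 1 * σ ^ 2 := by
    simp only [ht, mul_sub, Finset.sum_sub_distrib, mul_left_comm _ B, ← sq, ← Finset.mul_sum,
      ← Finset.sum_mul, ← hσ, ← hQ]
    ring
  have hsum_sq : ∑ y ∈ C, t y ^ 2 = B * (B * Q - v 1 * σ ^ 2) - v 1 * A * σ ^ 2 := by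
    have hexpand : ∀ y ∈ C, t y ^ 2 = B * (v (G.dist x y) * t y) - v 1 * σ * t y :=
      fun y _ => by rw [ht]; ring
    rw [Finset.sum_congr rfl hexpand, Finset.sum_sub_distrib, ← Finset.mul_sum, ← Finset.mul_sum,
      hsum, hsum_mul]
    ring
  have hquad := h.clique_quadForm_nonneg hv hC x (-(A * B)) t
  rw [hsum, hsum_mul, hsum_sq] at hquad
  have hAB : 0 < A * B := mul_pos (sub_pos.2 hv1) hCv
  refine sub_nonneg.1 (nonneg_of_mul_nonneg_right (hquad.trans_eq ?_) hAB)
  rw [← hA]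
  ring

theorem IsDistanceRegular.sum_clique_eq_zero (h : IsDistanceRegular G bi ci)
    (hv : IsCosineSequence bi ci G.diam θ v) (hC : G.IsClique (C : Set V)) (x : V)
    (hCv : 1 + ((C.card : ℝ) - 1) * v 1 = 0) : ∑ y ∈ C, v (G.dist x y) = 0 := by
  have hquad := h.clique_quadForm_nonneg hv hC x (-∑ y ∈ C, v (G.dist x y)) 1
  simp only [Pi.one_apply, mul_one, one_pow, Finset.sum_const, nsmul_eq_mul] at hquad
  refine pow_eq_zero_iff two_ne_zero |>.1 (le_antisymm ?_ (sq_nonneg _))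
  linear_combination hquad + (C.card : ℝ) * hCv

end Clique

theorem mul_le_sq_of_cosine_le {φ β u w E : ℝ} (hu0 : 0 < u) (hu1 : u < 1) (hE : 0 < E)
    (h : (1 + β * u) * (φ * (w + (1 - u) / E) ^ 2 + (1 + β - φ) * w ^ 2)
        - u * (φ * (w + (1 - u) / E) + (1 + β - φ) * w) ^ 2 ≤ (1 - u) * (1 + β * u)) :
    (β + 1 / u) * (φ + E ^ 2 * (w ^ 2 - u) / ((1 - u) * u)) ≤ (φ - E * w / u) ^ 2 := by
  have hu : 0 < 1 - u := sub_pos.2 hu1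
  have hscale : 0 < u * ((1 - u) / E) ^ 2 := by positivity
  refine sub_nonneg.1 (nonneg_of_mul_nonneg_right ((sub_nonneg.2 h).trans_eq ?_) hscale)
  field_simp
  ring

theorem mul_secondCosine_two_div {D : ℕ} {b α β : ℝ} (hb : b ≠ 0)
    (hu : secondCosine D b α β 1 ≠ 0) :
    b * secondCosine D b α β 2 / secondCosine D b α β 1
      = b + 1 - 1 / secondCosine D b α β 1 := by
  rw [secondCosine_succ D b α β 1]
  field_simp
  ring

theorem sq_mul_secondCosine_three_div {D : ℕ} {b α β : ℝ} (hb : b ≠ 0)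
    (hu : secondCosine D b α β 1 ≠ 0) :
    b ^ 2 * secondCosine D b α β 3 / secondCosine D b α β 1
      = b ^ 2 + b + 1 - (b + 1) / secondCosine D b α β 1 := by
  rw [secondCosine_succ D b α β 2, secondCosine_succ D b α β 1]
  field_simp
  ring

theorem IsGeometricPhi.pos {V : Type*} [Fintype V] [DecidableEq V] {G : SimpleGraph V}
    [DecidableRel G.Adj] {j p : ℕ} (hp : IsGeometricPhi G j p) : 0 < p := by
  obtain ⟨C, x, -, ⟨⟨y, hy, hxy⟩, -⟩, rfl⟩ := hp
  exact Finset.card_pos.2 ⟨y, Finset.mem_filter.2 ⟨hy, hxy⟩⟩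

namespace HasClassicalParameters

variable {V : Type*} [Fintype V] [DecidableEq V] {G : SimpleGraph V} [DecidableRel G.Adj]
  {bi ci : ℕ → ℕ} {D : ℕ} {b α β : ℝ} {j p : ℕ}

/- The cosine vector of the smallest eigenvalue is orthogonal to the Delsarte cliques, and its
entries on a clique take two values. -/
theorem phi_eq (hc : HasClassicalParameters G bi ci D b α β) (hb : 0 < b) (hj : j < D)
    (hp : IsGeometricPhi G j p) : (p : ℝ) = 1 + α * gaussNumber b j := by
  obtain ⟨C, x, hC, hx, rfl⟩ := hp
  set p := (C.filter fun y => G.dist x y = j).card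
  have hD : 0 < D := j.zero_le.trans_lt hj
  have hcard := hc.card_delsarteClique hb hD hC
  have hone : minCosineAbs b α β 1 * β = 1 := by
    simpa [gaussNumber_zero, minCosineAbs_zero] using hc.minCosineAbs_succ_mul hb hD
  have hsum := hc.1.sum_clique_eq_zero (hc.isCosineSequence_minCosine hb) hC.1 x
    (by rw [hcard]; linear_combination -hone)
  rw [hx.sum_dist hc.1.1 hC.1 fun i => (-1) ^ i * minCosineAbs b α β i, hcard] at hsum
  have hbalance : (p : ℝ) * minCosineAbs b α β j = (1 + β - p) * minCosineAbs b α β (j + 1) := by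
    refine mul_left_cancel₀ (pow_ne_zero j (neg_ne_zero.2 (one_ne_zero (α := ℝ)))) ?_
    rw [pow_succ] at hsum
    linear_combination hsum
  have hne : minCosineAbs b α β j * (1 + β) ≠ 0 :=
    (mul_pos (hc.minCosineAbs_pos hb hj.le) (by linarith [hc.beta_pos hb hD])).ne'
  refine mul_left_cancel₀ hne ?_
  linear_combination (β - α * gaussNumber b j) * hbalance
    + (1 + β - p) * hc.minCosineAbs_succ_mul hb hj

theorem phi_le_beta (hc : HasClassicalParameters G bi ci D b α β) (hb : 0 < b) (hj : j < D)
    (hp : IsGeometricPhi G j p) : (p : ℝ) ≤ β := by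
  have hphi := hc.phi_eq hb hj hp
  obtain ⟨C, x, hC, -, -⟩ := hp
  have hcard := hc.card_delsarteClique hb (j.zero_le.trans_lt hj) hC
  have hlt : (p : ℝ) < C.card := by linarith [hc.beta_sub_pos hb hj]
  have hle : (p : ℝ) + 1 ≤ C.card := by exact_mod_cast hlt
  linarith

theorem alpha_nonneg (hc : HasClassicalParameters G bi ci D b α β) (hb : 0 < b) (hj0 : 0 < j)
    (hj : j < D) (hp : IsGeometricPhi G j p) : 0 ≤ α := by
  have hpos : (1 : ℝ) ≤ p := Nat.one_le_cast.2 hp.pos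
  rw [hc.phi_eq hb hj hp, le_add_iff_nonneg_right] at hpos
  exact nonneg_of_mul_nonneg_left hpos (gaussNumber_pos hb hj0)

theorem one_le_beta_sub_alpha (hc : HasClassicalParameters G bi ci D b α β) (hb : 0 < b)
    (hj0 : 0 < j) (hj : j < D) (hp : IsGeometricPhi G j p) : 1 ≤ β - α := by
  have hone : 1 ≤ gaussNumber b j :=
    (gaussNumber_one b).symm.trans_le ((gaussNumber_strictMono hb).monotone hj0)
  have hle := hc.phi_le_beta hb hj hp
  rw [hc.phi_eq hb hj hp] at hle
  linarith [le_mul_of_one_le_right (hc.alpha_nonneg hb hj0 hj hp) hone]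

theorem secondCosine_one_mem_Ioo (hc : HasClassicalParameters G bi ci D b α β) (hD : 3 ≤ D)
    (hb : 0 < b) (hj0 : 0 < j) (hj : j < D) (hp : IsGeometricPhi G j p) :
    secondCosine D b α β 1 ∈ Set.Ioo (0 : ℝ) 1 := by
  have hβ := hc.beta_pos hb (by omega)
  exact ⟨secondCosine_one_pos hD hb hβ (hc.one_le_beta_sub_alpha hb hj0 hj hp),
    secondCosine_one_lt_one (by omega) hb (hc.alpha_nonneg hb hj0 hj hp) hβ⟩

theorem mul_le_sq_phi (hc : HasClassicalParameters G bi ci D b α β) (hD : 3 ≤ D) (hb : 0 < b)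
    (hj0 : 0 < j) (hj : j < D) (hp : IsGeometricPhi G j p) :
    (β + 1 / secondCosine D b α β 1)
        * (p + (b ^ j) ^ 2 * (secondCosine D b α β (j + 1) ^ 2 - secondCosine D b α β 1)
          / ((1 - secondCosine D b α β 1) * secondCosine D b α β 1))
      ≤ (p - b ^ j * secondCosine D b α β (j + 1) / secondCosine D b α β 1) ^ 2 := by
  obtain ⟨hpos, hlt_one⟩ := hc.secondCosine_one_mem_Ioo hD hb hj0 hj hp
  obtain ⟨C, x, hC, hx, rfl⟩ := hp
  have hcard := hc.card_delsarteClique hb (by omega) hC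
  have hβ := hc.beta_pos hb (by omega)
  refine mul_le_sq_of_cosine_le hpos hlt_one (pow_pos hb j) ?_
  have hschur := hc.1.sum_sq_clique_le (hc.isCosineSequence_secondCosine hb (by omega)) hC.1 x
    hlt_one (by rw [hcard, add_sub_cancel_left]; positivity)
  rwa [hx.sum_dist hc.1.1 hC.1, hx.sum_dist hc.1.1 hC.1 fun i => secondCosine D b α β i ^ 2,
    hcard, add_sub_cancel_left,
    sub_eq_iff_eq_add.1 (secondCosine_succ D b α β j).symm] at hschur

theorem mul_le_sq_phi_one (hc : HasClassicalParameters G bi ci D b α β) (hD : 3 ≤ D)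
    (hb : 0 < b) (hp : IsGeometricPhi G 1 p) :
    (β + 1 / secondCosine D b α β 1) * (p - b ^ 2 - 2 * b - 1 + 1 / secondCosine D b α β 1)
      ≤ (p - b * secondCosine D b α β 2 / secondCosine D b α β 1) ^ 2 := by
  obtain ⟨hpos, hlt_one⟩ := hc.secondCosine_one_mem_Ioo hD hb one_pos (by omega) hp
  have hbound := hc.mul_le_sq_phi hD hb one_pos (by omega) hp
  rw [pow_one] at hbound
  refine (congrArg _ ?_).trans_le hbound
  rw [secondCosine_succ D b α β 1]
  have hne := (sub_pos.2 hlt_one).ne'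
  field_simp
  ring

theorem mul_le_sq_phi_two (hc : HasClassicalParameters G bi ci D b α β) (hD : 3 ≤ D)
    (hb : 0 < b) (hp : IsGeometricPhi G 2 p) :
    (β + 1 / secondCosine D b α β 1)
        * (p - b ^ 4 - 2 * b ^ 3
          - b ^ 2 * (1 + (2 * secondCosine D b α β 2 - 1) / secondCosine D b α β 1) - 1
          + 1 / secondCosine D b α β 1)
      ≤ (p - b ^ 2 * secondCosine D b α β 3 / secondCosine D b α β 1) ^ 2 := by
  obtain ⟨hpos, hlt_one⟩ := hc.secondCosine_one_mem_Ioo hD hb two_pos (by omega) hp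
  refine (congrArg _ ?_).trans_le (hc.mul_le_sq_phi hD hb two_pos (by omega) hp)
  rw [secondCosine_succ D b α β 2, secondCosine_succ D b α β 1]
  have hne := (sub_pos.2 hlt_one).ne'
  field_simp
  ring

theorem inv_secondCosine_one_le (hc : HasClassicalParameters G bi ci D b α β) (hD : 3 ≤ D)
    (hb : 2 ≤ b) (hα : b ^ 2 + 2 * b ≤ α) : 1 / secondCosine D b α β 1 ≤ b ^ 2 + b + 1 := by
  have hb0 : 0 < b := by linarith
  obtain ⟨m, rfl⟩ : ∃ m, D = m + 3 := ⟨D - 3, by omega⟩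
  set g := gaussNumber b (m + 1)
  have hg1 : 1 ≤ g :=
    (gaussNumber_one b).symm.trans_le ((gaussNumber_strictMono hb0).monotone (by omega))
  have hg2 : gaussNumber b (m + 2) = 1 + b * g := gaussNumber_succ b (m + 1)
  have hβ := hc.beta_sub_pos hb0 (i := m + 2) (by omega)
  rw [hg2, sub_pos] at hβ
  have hbg : 2 ≤ b * g := by nlinarith
  have hβ1 : 1 ≤ β := by nlinarith
  have hθ : b * g * β - 1 ≤ secondEigenvalue (m + 3) b α β := by
    rw [secondEigenvalue_succ hb0.ne', hg2]
    linarith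
  have hpos : 0 < b * g * β - 1 := by nlinarith
  rw [secondCosine_one, one_div_div, div_le_iff₀ (hpos.trans_le hθ)]
  refine le_trans ?_ (mul_le_mul_of_nonneg_left hθ (by positivity))
  rw [gaussNumber_succ, hg2]
  have hexcess : 0 ≤ (b ^ 3 + b) * β * (g - 1) := mul_nonneg (by positivity) (by linarith)
  have hrest : 0 ≤ (b ^ 2 + b + 1) * (β * (b - 1) - 1) :=
    mul_nonneg (by positivity) (by nlinarith)
  nlinarith

theorem beta_mul_le_sq_phi_one (hc : HasClassicalParameters G bi ci D b α β) (hD : 3 ≤ D)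
    (hb : 2 ≤ b) (hp : IsGeometricPhi G 1 p) :
    β * (p - b ^ 2 - 2 * b - 1) ≤ (p + 7 * b ^ 2 / 2) ^ 2 := by
  have hb0 : 0 < b := by linarith
  have hβ := hc.beta_pos hb0 (by omega)
  obtain ⟨hpos, -⟩ := hc.secondCosine_one_mem_Ioo hD hb0 one_pos (by omega) hp
  have hphi := hc.phi_eq hb0 (by omega) hp
  rw [gaussNumber_one, mul_one] at hphi
  rcases lt_or_ge α (b ^ 2 + 2 * b) with hα | hα
  · exact (mul_nonpos_of_nonneg_of_nonpos hβ.le (by linarith)).trans (sq_nonneg _)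
  · have hbound := hc.mul_le_sq_phi_one hD hb0 hp
    rw [mul_secondCosine_two_div hb0.ne' hpos.ne'] at hbound
    have hinv_pos := one_div_pos.2 hpos
    have hinv := hc.inv_secondCosine_one_le hD hb hα
    set t := 1 / secondCosine D b α β 1
    calc β * (p - b ^ 2 - 2 * b - 1) ≤ (β + t) * (p - b ^ 2 - 2 * b - 1 + t) :=
          mul_le_mul (by linarith) (by linarith) (by linarith) (by linarith)
      _ ≤ (p - (b + 1 - t)) ^ 2 := hbound
      _ ≤ (p + 7 * b ^ 2 / 2) ^ 2 :=
          pow_le_pow_left₀ (by rw [hphi]; nlinarith) (by nlinarith) 2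

theorem beta_mul_le_sq_phi_two (hc : HasClassicalParameters G bi ci D b α β) (hD : 3 ≤ D)
    (hb : 2 ≤ b) (hp : IsGeometricPhi G 2 p) :
    β * (p - b ^ 4 - 11 * b ^ 3 / 2 - b ^ 2 - 1) ≤ (p + 7 * b ^ 3 / 2) ^ 2 := by
  have hb0 : 0 < b := by linarith
  have hβ := hc.beta_pos hb0 (by omega)
  obtain ⟨hpos, -⟩ := hc.secondCosine_one_mem_Ioo hD hb0 two_pos (by omega) hp
  have hphi := hc.phi_eq hb0 (by omega) hp
  rw [gaussNumber_two] at hphi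
  have hsq : 0 ≤ b * (b - 2) := mul_nonneg hb0.le (by linarith)
  have hcube : 0 ≤ b ^ 2 * (b - 2) := mul_nonneg (sq_nonneg b) (by linarith)
  rcases le_total (p - b ^ 4 - 11 * b ^ 3 / 2 - b ^ 2 - 1 : ℝ) 0 with hneg | hnonneg
  · exact (mul_nonpos_of_nonneg_of_nonpos hβ.le hneg).trans (sq_nonneg _)
  · have hα : b ^ 2 + 2 * b ≤ α := by
      refine le_of_mul_le_mul_right ?_ (show 0 < 1 + b by linarith)
      nlinarith [pow_pos hb0 4]
    have hbound := hc.mul_le_sq_phi_two hD hb0 hp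
    have hfactor : b ^ 2 * (1 + (2 * secondCosine D b α β 2 - 1) / secondCosine D b α β 1)
        = b ^ 2 + 2 * b * (b + 1 - 1 / secondCosine D b α β 1)
          - b ^ 2 * (1 / secondCosine D b α β 1) := by
      rw [← mul_secondCosine_two_div hb0.ne' hpos.ne']
      ring
    rw [hfactor, sq_mul_secondCosine_three_div hb0.ne' hpos.ne', ← mul_one_div (b + 1)] at hbound
    have hinv_pos := one_div_pos.2 hpos
    have hinv := hc.inv_secondCosine_one_le hD hb hα
    set t := 1 / secondCosine D b α β 1
    refine (mul_le_mul ?_ ?_ hnonneg ?_).trans (hbound.trans (pow_le_pow_left₀ ?_ ?_ 2))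
    · linarith
    · nlinarith [mul_nonneg (sq_nonneg (1 + b)) hinv_pos.le]
    · linarith
    · rw [hphi]
      nlinarith
    · nlinarith [mul_le_mul_of_nonneg_left hinv (show 0 ≤ b + 1 by linarith)]

end HasClassicalParameters

theorem mainTheorem11_general {V : Type*} [Fintype V] [DecidableEq V] (G : SimpleGraph V)
    [DecidableRel G.Adj] (bi ci : ℕ → ℕ) (D : ℕ) (b α β : ℝ)
    (hD : 3 ≤ D) (hb : 0 < b)
    (hclassical : HasClassicalParameters G bi ci D b α β)
    (θ₁ : ℝ) (hθ₁ : IsSecondLargestEigenvalue G θ₁)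
    (u : ℕ → ℝ) (hu : IsStandardSequence bi ci D θ₁ u)
    (φ₁ φ₂ : ℕ) (hφ₁ : IsGeometricPhi G 1 φ₁) (hφ₂ : IsGeometricPhi G 2 φ₂) :
    u 1 ≠ 0 ∧
    ((φ₁ : ℝ) - b * u 2 / u 1) ^ 2
        ≥ (β + 1 / u 1) * ((φ₁ : ℝ) - b ^ 2 - 2 * b - 1 + 1 / u 1) ∧
    ((φ₂ : ℝ) - b ^ 2 * u 3 / u 1) ^ 2
        ≥ (β + 1 / u 1) * ((φ₂ : ℝ) - b ^ 4 - 2 * b ^ 3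
            - b ^ 2 * (1 + (2 * u 2 - 1) / u 1) - 1 + 1 / u 1) ∧
    (2 ≤ b →
      ((φ₁ : ℝ) + 7 * b ^ 2 / 2) ^ 2 ≥ β * ((φ₁ : ℝ) - b ^ 2 - 2 * b - 1) ∧
      ((φ₂ : ℝ) + 7 * b ^ 3 / 2) ^ 2
        ≥ β * ((φ₂ : ℝ) - b ^ 4 - 11 * b ^ 3 / 2 - b ^ 2 - 1)) := by
  have hD0 : 0 < D := by omega
  have hα : 0 ≤ α := hclassical.alpha_nonneg hb one_pos (by omega) hφ₁
  obtain rfl := hclassical.eq_secondEigenvalue hb hD0 hα hθ₁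
  have hcosine := hclassical.isCosineSequence_secondCosine hb hD0
  have hu_eq : ∀ i ≤ D, u i = secondCosine D b α β i := by
    rw [← hclassical.2.1] at hu ⊢
    exact hu.eq_of_isCosineSequence hclassical.1 (hclassical.2.1 ▸ hcosine)
  rw [hu_eq 1 (by omega), hu_eq 2 (by omega), hu_eq 3 hD]
  exact ⟨(hclassical.secondCosine_one_mem_Ioo hD hb one_pos (by omega) hφ₁).1.ne',
    hclassical.mul_le_sq_phi_one hD hb hφ₁, hclassical.mul_le_sq_phi_two hD hb hφ₂,
    fun hb2 => ⟨hclassical.beta_mul_le_sq_phi_one hD hb2 hφ₁,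
      hclassical.beta_mul_le_sq_phi_two hD hb2 hφ₂⟩⟩

theorem mainTheorem11 {V : Type*} [Fintype V] [DecidableEq V] (G : SimpleGraph V)
    [DecidableRel G.Adj] (bi ci : ℕ → ℕ) (D : ℕ) (b α β : ℝ)
    (hD : 3 ≤ D) (hb : 0 < b)
    (hclassical : HasClassicalParameters G bi ci D b α β)
    (hgeometric : IsGeometric G)
    (θ₁ : ℝ) (hθ₁ : IsSecondLargestEigenvalue G θ₁)
    (u : ℕ → ℝ) (hu : IsStandardSequence bi ci D θ₁ u)
    (φ₁ φ₂ : ℕ) (hφ₁ : IsGeometricPhi G 1 φ₁) (hφ₂ : IsGeometricPhi G 2 φ₂) :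
    u 1 ≠ 0 ∧
    ((φ₁ : ℝ) - b * u 2 / u 1) ^ 2
        ≥ (β + 1 / u 1) * ((φ₁ : ℝ) - b ^ 2 - 2 * b - 1 + 1 / u 1) ∧
    ((φ₂ : ℝ) - b ^ 2 * u 3 / u 1) ^ 2
        ≥ (β + 1 / u 1) * ((φ₂ : ℝ) - b ^ 4 - 2 * b ^ 3
            - b ^ 2 * (1 + (2 * u 2 - 1) / u 1) - 1 + 1 / u 1) ∧
    (2 ≤ b →
      ((φ₁ : ℝ) + 7 * b ^ 2 / 2) ^ 2 ≥ β * ((φ₁ : ℝ) - b ^ 2 - 2 * b - 1) ∧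
      ((φ₂ : ℝ) + 7 * b ^ 3 / 2) ^ 2
        ≥ β * ((φ₂ : ℝ) - b ^ 4 - 11 * b ^ 3 / 2 - b ^ 2 - 1)) :=
  mainTheorem11_general G bi ci D b α β hD hb hclassical θ₁ hθ₁ u hu φ₁ φ₂ hφ₁ hφ₂
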